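/- Let $n\ge 1$, let $A,B$ be Hermitian complex $n\times n$ matrices, and let $X,Y$ be complex $n\times n$ matrices satisfying $X^*X+Y^*Y=XX^*+YY^*=I$. Then there exist unitary complex $2n\times 2n$ matrices $U_1,\dots,U_{2n}$ such that $$ (X^*AX+Y^*BY)\oplus(Y^*AY+X^*BX)=\frac{1}{2n}\sum_{k=1}^{2n}U_k(A\oplus B)U_k^*, $$ where $S\oplus T$ denotes the block-diagonal matrix $\begin{bmatrix}S&0\\0&T\end{bmatrix}$. -/

import Mathlib

open scoped Matrix

/-! The left side is `∑ a, K a * T * (K a)ᴴ` with `T = A ⊕ B` and Kraus operators `Xᴴ ⊕ Xᴴ` and the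
block-antidiagonal `Yᴴ, Yᴴ`; the two hypotheses say that this map is unital and trace-preserving.
For such a map, the output eigenvalues `m` are a doubly stochastic image of the input eigenvalues
`l`. By Schur–Horn (`exists_unitary_diag_eq`) some unitary conjugate of `diagonal l` has diagonal
`m`, and averaging over `N` diagonal unitaries (`exists_unitary_pinching`) erases the rest. Undoing
both diagonalizations gives the average. -/

open Matrix Finset in
/-- A Hermitian matrix is diagonalised by a unitary whose columns are ordered by decreasing
eigenvalue. -/
theorem Matrix.IsHermitian.exists_antitone_diagonalization {ι : Type*} [Fintype ι] [DecidableEq ι]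
    {T : Matrix ι ι ℂ} (hT : T.IsHermitian) :
    ∃ (V : Matrix ι (Fin (Fintype.card ι)) ℂ) (l : Fin (Fintype.card ι) → ℝ),
      V * Vᴴ = 1 ∧ Vᴴ * V = 1 ∧ Antitone l ∧ T = V * diagonal (fun i => (l i : ℂ)) * Vᴴ := by
  let e : Fin (Fintype.card ι) ≃ ι := Fintype.equivOfCardEq (Fintype.card_fin _)
  have hU := hT.eigenvectorUnitary.2
  set U : Matrix ι ι ℂ := (hT.eigenvectorUnitary : Matrix ι ι ℂ) with hUdef
  have h1 : U * Uᴴ = 1 := mem_unitaryGroup_iff.1 hU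
  have h2 : Uᴴ * U = 1 := mem_unitaryGroup_iff'.1 hU
  have hl : (diagonal (fun i => (hT.eigenvalues₀ i : ℂ)) : Matrix _ _ ℂ) =
      (diagonal (fun i => (hT.eigenvalues i : ℂ))).submatrix e e := by
    rw [submatrix_diagonal_equiv]
    congr 1
    funext i
    simp [IsHermitian.eigenvalues, e]
  refine ⟨U.submatrix id e, hT.eigenvalues₀, ?_, ?_, hT.eigenvalues₀_antitone, ?_⟩
  · rw [conjTranspose_submatrix, submatrix_mul_equiv, h1, submatrix_id_id]
  · rw [conjTranspose_submatrix, ← submatrix_mul _ _ _ _ _ Function.bijective_id, h2,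
      submatrix_one_equiv]
  · rw [hl, conjTranspose_submatrix, submatrix_mul_equiv, submatrix_mul_equiv, submatrix_id_id]
    have := hT.spectral_theorem
    rw [Unitary.conjStarAlgAut_apply] at this
    exact this

/-! ### Majorization -/

/-- Hardy–Littlewood–Pólya: if the partial sums of `d` dominate those of the antitone vector `m`
and the totals agree, then `m` is reached from `d` by finitely many transfers from a larger
coordinate to a smaller one. -/
theorem induction_on_transfers {N : ℕ} {m : Fin N → ℝ} (hm : Antitone m)
    {P : (Fin N → ℝ) → Prop}
    (hP : ∀ (d : Fin N → ℝ) (i j : Fin N) (δ : ℝ), i ≠ j → 0 ≤ δ → δ ≤ d i - d j → P d →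
      P (d - Pi.single i δ + Pi.single j δ))
    (d : Fin N → ℝ) (hd : P d)
    (hle : ∀ k, ∑ i ∈ Finset.Iic k, m i ≤ ∑ i ∈ Finset.Iic k, d i)
    (heq : ∑ i, m i = ∑ i, d i) : P m := by
  induction hc : (Finset.univ.filter fun i => d i ≠ m i).card using Nat.strong_induction_on
    generalizing d with
  | _ c ih =>
  by_cases hdm : d = m
  · exact hdm ▸ hd
  have hneg : (Finset.univ.filter fun j => d j < m j).Nonempty := by
    by_contra hne
    have hall : ∀ j ∈ Finset.univ, m j ≤ d j := by
      intro j _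
      by_contra hj
      exact hne ⟨j, by simpa using hj⟩
    exact hdm (funext fun j => (((Finset.sum_eq_sum_iff_of_le hall).1 heq) j (by simp)).symm)
  obtain ⟨j, hj⟩ := Finset.exists_minimal hneg
  have hjlt : d j < m j := by simpa using hj.1
  have hbelow : ∀ p < j, m p ≤ d p := by
    intro p hp
    by_contra h
    exact absurd (hj.2 (y := p) (by simpa using h) hp.le) (not_le.2 hp)
  obtain ⟨i, hij, hi⟩ : ∃ i < j, m i < d i := by
    by_contra! h
    refine absurd (hle j) (not_le.2 (Finset.sum_lt_sum (fun p hp => ?_) ⟨j, by simp, hjlt⟩))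
    rcases (Finset.mem_Iic.1 hp).lt_or_eq with hp | rfl
    · exact h p hp
    · exact hjlt.le
  -- The largest transfer overshooting neither target: it settles coordinate `i` or `j`, so the
  -- number of mismatches drops.
  set δ := min (d i - m i) (m j - d j) with hδ
  have hδi : δ ≤ d i - m i := min_le_left _ _
  have hδj : δ ≤ m j - d j := min_le_right _ _
  have hδ0 : 0 < δ := lt_min (by linarith) (by linarith)
  have hmij := hm hij.le
  set d' := d - Pi.single i δ + Pi.single j δ with hd'
  have hd'i : d' i = d i - δ := by simp [hd', hij.ne]
  have hd'j : d' j = d j + δ := by simp [hd', hij.ne']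
  have hd'p : ∀ p, p ≠ i → p ≠ j → d' p = d p := fun p hp hq => by simp [hd', hp, hq]
  have hsum : ∀ s : Finset (Fin N), i ∈ s → j ∈ s → ∑ p ∈ s, d' p = ∑ p ∈ s, d p := by
    intro s his hjs
    simp [hd', Finset.sum_add_distrib, Finset.sum_sub_distrib, Finset.sum_pi_single', his, hjs]
  refine ih _ ?_ d' (hP d i j δ hij.ne hδ0.le (by linarith) hd) ?_ ?_ rfl
  · rw [← hc]
    apply Finset.card_lt_card
    refine Finset.ssubset_iff_subset_ne.2 ⟨fun p hp => ?_, fun h => ?_⟩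
    · simp only [Finset.mem_filter, Finset.mem_univ, true_and] at hp ⊢
      by_cases h1 : p = i
      · exact h1 ▸ hi.ne'
      by_cases h2 : p = j
      · exact h2 ▸ hjlt.ne
      rwa [hd'p p h1 h2] at hp
    · have hi' : i ∈ Finset.univ.filter fun p => d' p ≠ m p := by rw [h]; simpa using hi.ne'
      have hj' : j ∈ Finset.univ.filter fun p => d' p ≠ m p := by rw [h]; simpa using hjlt.ne
      simp only [Finset.mem_filter, Finset.mem_univ, true_and, hd'i, hd'j] at hi' hj'
      rcases min_choice (d i - m i) (m j - d j) with h | h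
      · exact hi' (by rw [hδ, h]; ring)
      · exact hj' (by rw [hδ, h]; ring)
  · intro k
    rcases lt_or_ge k j with hk | hk
    · refine Finset.sum_le_sum fun p hp => ?_
      have hpj : p < j := (Finset.mem_Iic.1 hp).trans_lt hk
      by_cases h1 : p = i
      · subst h1; rw [hd'i]; linarith
      · rw [hd'p p h1 hpj.ne]; exact hbelow p hpj
    · rw [hsum _ (by simpa using hij.le.trans hk) (by simpa using hk)]
      exact hle k
  · rw [hsum _ (by simp) (by simp)]; exact heq

/-- The partial sums of an antitone vector dominate those of its image under a doubly stochastic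
matrix. -/
theorem sum_Iic_doublyStochastic_le {N : ℕ} {l m : Fin N → ℝ} (hl : Antitone l)
    {D : Fin N → Fin N → ℝ} (h0 : ∀ i j, 0 ≤ D i j) (hrow : ∀ i, ∑ j, D i j = 1)
    (hcol : ∀ j, ∑ i, D i j = 1) (hm : ∀ i, m i = ∑ j, D i j * l j) (k : Fin N) :
    ∑ i ∈ Finset.Iic k, m i ≤ ∑ i ∈ Finset.Iic k, l i := by
  set w : Fin N → ℝ := fun j => ∑ i ∈ Finset.Iic k, D i j with hw
  have hw0 : ∀ j, 0 ≤ w j := fun j => Finset.sum_nonneg fun i _ => h0 i j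
  have hw1 : ∀ j, w j ≤ 1 := fun j => by
    rw [← hcol j]
    exact Finset.sum_le_sum_of_subset_of_nonneg (Finset.subset_univ _) fun i _ _ => h0 i j
  have hws : ∑ j, w j = ∑ j, if j ≤ k then (1 : ℝ) else 0 := by
    rw [hw, Finset.sum_comm]
    simp only [hrow, ← Finset.sum_filter]
    congr 1
    ext; simp
  have hms : ∑ i ∈ Finset.Iic k, m i = ∑ j, w j * l j := by
    simp only [hm, hw, Finset.sum_mul]
    exact Finset.sum_comm
  have hls : ∑ i ∈ Finset.Iic k, l i = ∑ j, (if j ≤ k then (1 : ℝ) else 0) * l j := by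
    simp only [ite_mul, one_mul, zero_mul, ← Finset.sum_filter]
    congr 1
    ext; simp
  -- Both weight vectors have the same total, so subtracting `l k` is free and makes every term
  -- nonnegative.
  have hpos : 0 ≤ ∑ j, ((if j ≤ k then (1 : ℝ) else 0) - w j) * (l j - l k) := by
    refine Finset.sum_nonneg fun j _ => ?_
    split_ifs with hj
    · exact mul_nonneg (sub_nonneg.2 (hw1 j)) (sub_nonneg.2 (hl hj))
    · exact mul_nonneg_of_nonpos_of_nonpos (by linarith [hw0 j])
        (sub_nonpos.2 (hl (not_le.1 hj).le))
  have hexp : ∑ j, ((if j ≤ k then (1 : ℝ) else 0) - w j) * (l j - l k) =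
      (∑ j, (if j ≤ k then (1 : ℝ) else 0) * l j - ∑ j, w j * l j) -
        (∑ j, (if j ≤ k then (1 : ℝ) else 0) - ∑ j, w j) * l k := by
    rw [← Finset.sum_sub_distrib, ← Finset.sum_sub_distrib, Finset.sum_mul,
      ← Finset.sum_sub_distrib]
    exact Finset.sum_congr rfl fun j _ => by ring
  rw [hexp, hws, sub_self, zero_mul, sub_zero] at hpos
  rw [hms, hls]
  linarith

/-! ### Schur–Horn by plane rotations -/

/-- This phase cancels the off-diagonal contribution to the diagonal of a rotated Hermitian matrix.
-/
theorem Complex.exists_unit_rotating_to_imaginary (b : ℂ) :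
    ∃ z : ℂ, z * star z = 1 ∧ star z * b + z * star b = 0 := by
  by_cases hb : b = 0
  · exact ⟨1, by simp [hb]⟩
  have hn : (‖b‖ : ℂ) ≠ 0 := by simpa using hb
  have hbb : b * star b = (‖b‖ : ℂ) ^ 2 := Complex.mul_conj' b
  refine ⟨Complex.I * b / ‖b‖, ?_, ?_⟩
  · simp only [star_div₀, star_mul', Complex.star_def, Complex.conj_I, Complex.conj_ofReal] at hbb ⊢
    field_simp
    linear_combination (-Complex.I ^ 2) * hbb - (‖b‖ : ℂ) ^ 2 * Complex.I_sq
  · simp only [star_div₀, star_mul', Complex.star_def, Complex.conj_I, Complex.conj_ofReal]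
    ring

open Matrix in
/-- Conjugating by a rotation in the plane of the `i`-th and `j`-th coordinates transfers any
admissible amount between the two diagonal entries. -/
theorem Matrix.IsHermitian.exists_unitary_diag_transfer {N : ℕ} {M : Matrix (Fin N) (Fin N) ℂ}
    (hM : M.IsHermitian) {d : Fin N → ℝ} (hd : ∀ p, M p p = d p) {i j : Fin N} (hij : i ≠ j)
    {δ : ℝ} (h0 : 0 ≤ δ) (hδ : δ ≤ d i - d j) :
    ∃ W ∈ unitaryGroup (Fin N) ℂ, ∀ p, (W * M * Wᴴ) p p =
      ((d - Pi.single i δ + Pi.single j δ : Fin N → ℝ) p : ℂ) := by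
  obtain ⟨z, hz, hzM⟩ := Complex.exists_unit_rotating_to_imaginary (M i j)
  have hz' : z * (starRingEnd ℂ) z = 1 := hz
  have hji : star (M i j) = M j i := hM.apply j i
  rw [hji] at hzM
  -- The rotated `i`-th entry will be `c² d i + s² d j = d i - s² (d i - d j)`. If `d i = d j`, then
  -- `δ = 0` and the convention `0 / 0 = 0` fits.
  obtain ⟨c, s, hcs, hs⟩ : ∃ c s : ℝ, c ^ 2 + s ^ 2 = 1 ∧ s ^ 2 * (d i - d j) = δ := by
    have hq0 : 0 ≤ δ / (d i - d j) := div_nonneg h0 (h0.trans hδ)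
    have hq1 : δ / (d i - d j) ≤ 1 := div_le_one_of_le₀ hδ (h0.trans hδ)
    refine ⟨√(1 - δ / (d i - d j)), √(δ / (d i - d j)), ?_, ?_⟩
    · rw [Real.sq_sqrt hq0, Real.sq_sqrt (by linarith)]; ring
    · rw [Real.sq_sqrt hq0]
      refine div_mul_cancel_of_imp fun h => ?_
      linarith
  have hcs' : (c : ℂ) ^ 2 + (s : ℂ) ^ 2 = 1 := by exact_mod_cast hcs
  have hs' : (s : ℂ) ^ 2 * (d i - d j) = δ := by exact_mod_cast hs
  set r : Fin N → Fin N → ℂ := fun p =>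
    if p = i then Pi.single i (c : ℂ) + Pi.single j (s * z)
    else if p = j then Pi.single i (-(s * star z)) + Pi.single j (c : ℂ)
    else Pi.single p 1 with hr
  have ri : r i = Pi.single i (c : ℂ) + Pi.single j (s * z) := by simp [hr]
  have rj : r j = Pi.single i (-(s * star z)) + Pi.single j (c : ℂ) := by simp [hr, hij.symm]
  have rp : ∀ p, p ≠ i → p ≠ j → r p = Pi.single p 1 := fun p hp hq => by simp [hr, hp, hq]
  have hentry : ∀ (L : Matrix (Fin N) (Fin N) ℂ) (p q : Fin N),
      (of r * L * (of r)ᴴ) p q = (r p ᵥ* L) ⬝ᵥ star (r q) := fun _ _ _ => rfl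
  have hone : ∀ p q, r p ⬝ᵥ star (r q) = (1 : Matrix (Fin N) (Fin N) ℂ) p q := by
    intro p q
    by_cases hpi : p = i
    · subst hpi
      by_cases hqi : q = p
      · subst hqi
        rw [ri]
        simp [hij, hij.symm]
        linear_combination hcs' + s ^ 2 * hz'
      by_cases hqj : q = j
      · subst hqj
        rw [ri, rj]
        simp [hij, hij.symm]
        ring
      · rw [ri, rp q hqi hqj]
        simp [Ne.symm hqi, Ne.symm hqj]
    by_cases hpj : p = j
    · subst hpj
      by_cases hqi : q = i
      · subst hqi
        rw [ri, rj]
        simp [hij, hij.symm]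
        ring
      by_cases hqj : q = p
      · subst hqj
        rw [rj]
        simp [hij, hij.symm]
        linear_combination hcs' + s ^ 2 * hz'
      · rw [rj, rp q hqi hqj]
        simp [Ne.symm hqi, Ne.symm hqj]
    rw [rp p hpi hpj]
    by_cases hqi : q = i
    · subst hqi
      rw [ri]
      simp [hpi, hpj]
    by_cases hqj : q = j
    · subst hqj
      rw [rj]
      simp [hpi, hpj]
    rw [rp q hqi hqj]
    simp [Pi.single_apply, Matrix.one_apply, eq_comm]
  refine ⟨of r, ?_, fun p => ?_⟩
  · rw [mem_unitaryGroup_iff]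
    ext p q
    rw [← hone p q]
    rfl
  rw [hentry]
  by_cases hpi : p = i
  · subst hpi
    rw [ri]
    simp [hij, add_vecMul, hd] at hzM hz ⊢
    linear_combination (d p : ℂ) * hcs' - hs' + c * s * hzM + s ^ 2 * d j * hz
  by_cases hpj : p = j
  · subst hpj
    rw [rj]
    simp [hij.symm, add_vecMul, hd] at hzM hz ⊢
    linear_combination (d p : ℂ) * hcs' + hs' - c * s * hzM + s ^ 2 * d i * hz
  · rw [rp p hpi hpj]
    simp [hpi, hpj, hd]

open Matrix in
/-- The nontrivial half of the Schur–Horn theorem, for vectors related by a doubly stochastic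
matrix. -/
theorem exists_unitary_diag_eq {N : ℕ} {l m : Fin N → ℝ} (hl : Antitone l) (hm : Antitone m)
    {D : Fin N → Fin N → ℝ} (h0 : ∀ i j, 0 ≤ D i j) (hrow : ∀ i, ∑ j, D i j = 1)
    (hcol : ∀ j, ∑ i, D i j = 1) (hD : ∀ i, m i = ∑ j, D i j * l j) :
    ∃ W ∈ unitaryGroup (Fin N) ℂ, ∀ p,
      (W * diagonal (fun i => (l i : ℂ)) * Wᴴ) p p = m p := by
  have hL : (diagonal (fun i => (l i : ℂ)) : Matrix (Fin N) (Fin N) ℂ).IsHermitian := by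
    rw [IsHermitian, diagonal_conjTranspose]
    congr 1
    funext i
    simp
  refine induction_on_transfers hm (P := fun d => ∃ W ∈ unitaryGroup (Fin N) ℂ, ∀ p,
      (W * diagonal (fun i => (l i : ℂ)) * Wᴴ) p p = d p) ?_ l ?_
      (sum_Iic_doublyStochastic_le hl h0 hrow hcol hD) ?_
  · rintro d i j δ hij hδ0 hδ ⟨W, hW, hWd⟩
    obtain ⟨W', hW', h⟩ := (isHermitian_mul_mul_conjTranspose W hL).exists_unitary_diag_transfer
      hWd hij hδ0 hδ
    refine ⟨W' * W, mul_mem hW' hW, fun p => ?_⟩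
    rw [← h p, conjTranspose_mul]
    simp only [Matrix.mul_assoc]
  · exact ⟨1, one_mem _, fun p => by simp⟩
  · simp only [hD]
    rw [Finset.sum_comm]
    simp only [← Finset.sum_mul, hcol, one_mul]

/-! ### Pinching and unitary averages -/

open Matrix in
/-- The pinching onto the diagonal is an average of `N` conjugations by unitary diagonal
matrices. -/
theorem exists_unitary_pinching (N : ℕ) : ∃ E : Fin N → Matrix (Fin N) (Fin N) ℂ,
    (∀ k, E k ∈ unitaryGroup (Fin N) ℂ) ∧ ∀ M : Matrix (Fin N) (Fin N) ℂ,
      diagonal (fun i => M i i) = (1 / (N : ℂ)) • ∑ k, E k * M * (E k)ᴴ := by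
  rcases Nat.eq_zero_or_pos N with rfl | hN
  · exact ⟨fun _ => 1, fun _ => one_mem _, fun M => Subsingleton.elim _ _⟩
  have hN' : (N : ℂ) ≠ 0 := by exact_mod_cast hN.ne'
  set ζ : ℂ := Complex.exp (2 * Real.pi * Complex.I / N) with hζ
  have hprim : IsPrimitiveRoot ζ N := Complex.isPrimitiveRoot_exp N hN.ne'
  have hnorm : ζ * star ζ = 1 := by
    rw [Complex.star_def, Complex.mul_conj', hprim.norm'_eq_one hN.ne']
    simp
  have hpow : ∀ a : ℕ, ζ ^ a * star ζ ^ a = 1 := fun a => by rw [← mul_pow, hnorm, one_pow]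
  -- Conjugation by the `k`-th matrix multiplies entry `(p, q)` by `ζ ^ (k (p - q))`, whose sum over
  -- `k` vanishes off the diagonal.
  refine ⟨fun k => diagonal fun p => ζ ^ ((k : ℕ) * (p : ℕ)), fun k => ?_, fun M => ?_⟩
  · rw [mem_unitaryGroup_iff, star_eq_conjTranspose, diagonal_conjTranspose, diagonal_mul_diagonal,
      ← diagonal_one]
    congr 1
    funext p
    simp only [Pi.star_apply, star_pow]
    exact hpow _
  · ext p q
    have hterm : ∀ k : Fin N, (diagonal (fun p : Fin N => ζ ^ ((k : ℕ) * (p : ℕ))) * M *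
        (diagonal fun p : Fin N => ζ ^ ((k : ℕ) * (p : ℕ)))ᴴ) p q =
          (ζ ^ (p : ℕ) * star ζ ^ (q : ℕ)) ^ (k : ℕ) * M p q := fun k => by
      rw [diagonal_conjTranspose, mul_diagonal, diagonal_mul]
      simp only [Pi.star_apply, star_pow]
      ring
    rw [Matrix.smul_apply, Matrix.sum_apply]
    simp only [hterm, ← Finset.sum_mul, smul_eq_mul]
    rw [Fin.sum_univ_eq_sum_range fun k => (ζ ^ (p : ℕ) * star ζ ^ (q : ℕ)) ^ k]
    by_cases hpq : p = q
    · subst hpq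
      simp only [hpow]
      simp [hN']
    · rw [diagonal_apply_ne _ hpq]
      have hx1 : ζ ^ (p : ℕ) * star ζ ^ (q : ℕ) ≠ 1 := fun h => by
        refine hpq (Fin.ext (hprim.pow_inj p.2 q.2 ?_))
        linear_combination ζ ^ (q : ℕ) * h - ζ ^ (p : ℕ) * hpow q
      have hxN : (ζ ^ (p : ℕ) * star ζ ^ (q : ℕ)) ^ N = 1 := by
        have hstar : star ζ ^ N = 1 := by rw [← star_pow, hprim.pow_eq_one, star_one]
        rw [mul_pow, pow_right_comm ζ, hprim.pow_eq_one, pow_right_comm (star ζ), hstar, one_pow,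
          one_pow, one_mul]
      have hgeom := mul_geom_sum (ζ ^ (p : ℕ) * star ζ ^ (q : ℕ)) N
      rw [hxN, sub_self] at hgeom
      rw [(mul_eq_zero.1 hgeom).resolve_left (sub_ne_zero.2 hx1)]
      simp

open Matrix in
/-- The image of a Hermitian matrix under a unital trace-preserving completely positive map is an
average of as many unitary conjugates of it as its size. -/
theorem Matrix.IsHermitian.exists_unitary_average {ι κ : Type*} [Fintype ι] [DecidableEq ι]
    [Fintype κ] {N : ℕ} (hN : Fintype.card ι = N) {T : Matrix ι ι ℂ} (hT : T.IsHermitian)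
    (K : κ → Matrix ι ι ℂ) (hK : ∑ a, K a * (K a)ᴴ = 1) (hK' : ∑ a, (K a)ᴴ * K a = 1) :
    ∃ U : Fin N → Matrix ι ι ℂ, (∀ k, U k ∈ unitaryGroup ι ℂ) ∧
      ∑ a, K a * T * (K a)ᴴ = (1 / (N : ℂ)) • ∑ k, U k * T * (U k)ᴴ := by
  subst hN
  have hS : (∑ a, K a * T * (K a)ᴴ).IsHermitian := by
    rw [IsHermitian, conjTranspose_sum]
    exact Finset.sum_congr rfl fun a _ => isHermitian_mul_mul_conjTranspose (K a) hT
  obtain ⟨V, l, hV, hV', hl, hTV⟩ := hT.exists_antitone_diagonalization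
  obtain ⟨Q, m, hQ, hQ', hm, hSQ⟩ := hS.exists_antitone_diagonalization
  set L := diagonal fun i => (l i : ℂ) with hLdef
  -- The Kraus operators in the two eigenbases; their squared moduli, summed over `a`, form the
  -- doubly stochastic matrix.
  set C : κ → Matrix _ _ ℂ := fun a => Qᴴ * K a * V with hC
  have hCC : ∑ a, C a * (C a)ᴴ = 1 := by
    calc ∑ a, C a * (C a)ᴴ = ∑ a, Qᴴ * (K a * (K a)ᴴ) * Q := by
          refine Finset.sum_congr rfl fun a _ => ?_
          calc C a * (C a)ᴴ = Qᴴ * (K a * (V * Vᴴ) * (K a)ᴴ) * Q := by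
                simp [hC, Matrix.mul_assoc]
            _ = _ := by rw [hV, Matrix.mul_one]
      _ = 1 := by rw [← Matrix.sum_mul, ← Matrix.mul_sum, hK, Matrix.mul_one, hQ']
  have hCC' : ∑ a, (C a)ᴴ * C a = 1 := by
    calc ∑ a, (C a)ᴴ * C a = ∑ a, Vᴴ * ((K a)ᴴ * K a) * V := by
          refine Finset.sum_congr rfl fun a _ => ?_
          calc (C a)ᴴ * C a = Vᴴ * ((K a)ᴴ * (Q * Qᴴ) * K a) * V := by
                simp [hC, Matrix.mul_assoc]
            _ = _ := by rw [hQ, Matrix.mul_one]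
      _ = 1 := by rw [← Matrix.sum_mul, ← Matrix.mul_sum, hK', Matrix.mul_one, hV']
  have hmC : diagonal (fun i => (m i : ℂ)) = ∑ a, C a * L * (C a)ᴴ := by
    calc diagonal (fun i => (m i : ℂ)) =
          (Qᴴ * Q) * diagonal (fun i => (m i : ℂ)) * (Qᴴ * Q) := by
            rw [hQ', Matrix.one_mul, Matrix.mul_one]
      _ = Qᴴ * (∑ a, K a * T * (K a)ᴴ) * Q := by rw [hSQ]; simp only [Matrix.mul_assoc]
      _ = ∑ a, Qᴴ * (K a * T * (K a)ᴴ) * Q := by rw [Matrix.mul_sum, Matrix.sum_mul]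
      _ = _ := by
        refine Finset.sum_congr rfl fun a _ => ?_
        rw [hTV]
        simp [hC, Matrix.mul_assoc]
  have hsq : ∀ z : ℂ, z * star z = (Complex.normSq z : ℂ) := fun z => Complex.mul_conj z
  obtain ⟨W, hW, hWm⟩ := exists_unitary_diag_eq hl hm (D := fun i j => ∑ a, Complex.normSq (C a i j))
    (fun i j => Finset.sum_nonneg fun a _ => Complex.normSq_nonneg _)
    (fun i => by
      have h := congrFun (congrFun hCC i) i
      simp only [sum_apply, mul_apply, conjTranspose_apply, one_apply_eq, hsq] at h
      rw [Finset.sum_comm]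
      exact_mod_cast h)
    (fun j => by
      have h := congrFun (congrFun hCC' j) j
      simp only [sum_apply, mul_apply, conjTranspose_apply, one_apply_eq, mul_comm (star _),
        hsq] at h
      rw [Finset.sum_comm]
      exact_mod_cast h)
    (fun i => by
      have h := congrFun (congrFun hmC i) i
      simp only [hLdef, sum_apply, mul_apply (M := _ * _), mul_diagonal, conjTranspose_apply,
        diagonal_apply_eq, mul_right_comm _ _ (star _), hsq] at h
      simp only [Finset.sum_mul]
      rw [Finset.sum_comm]
      exact_mod_cast h)
  obtain ⟨E, hE, hpinch⟩ := exists_unitary_pinching (Fintype.card ι)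
  have hVT : Vᴴ * T * V = L := by
    calc Vᴴ * T * V = (Vᴴ * V) * L * (Vᴴ * V) := by rw [hTV]; simp only [Matrix.mul_assoc]
      _ = L := by rw [hV', Matrix.one_mul, Matrix.mul_one]
  refine ⟨fun k => Q * (E k * W) * Vᴴ, fun k => ?_, ?_⟩
  · have hEW : E k * W * (E k * W)ᴴ = 1 := mem_unitaryGroup_iff.1 (mul_mem (hE k) hW)
    rw [mem_unitaryGroup_iff, star_eq_conjTranspose]
    calc Q * (E k * W) * Vᴴ * (Q * (E k * W) * Vᴴ)ᴴ
        = Q * (E k * W * (Vᴴ * V) * (E k * W)ᴴ) * Qᴴ := by simp [Matrix.mul_assoc]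
      _ = 1 := by rw [hV', Matrix.mul_one, hEW, Matrix.mul_one, hQ]
  · have hpm := hpinch (W * L * Wᴴ)
    rw [show (fun i => (W * L * Wᴴ) i i) = fun i => (m i : ℂ) from funext hWm] at hpm
    rw [hSQ, hpm, Matrix.mul_smul, Matrix.smul_mul, Matrix.mul_sum, Matrix.sum_mul]
    congr 1
    refine Finset.sum_congr rfl fun k _ => ?_
    rw [← hVT]
    simp [Matrix.mul_assoc]

theorem theorem4p3p2 (n : ℕ) (A B X Y : Matrix (Fin n) (Fin n) ℂ)
    (hA : A.IsHermitian) (hB : B.IsHermitian)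
    (hXY : Xᴴ * X + Yᴴ * Y = 1) (hXY' : X * Xᴴ + Y * Yᴴ = 1) :
    ∃ U : Fin (2 * n) → Matrix (Fin n ⊕ Fin n) (Fin n ⊕ Fin n) ℂ,
      (∀ k, U k ∈ Matrix.unitaryGroup (Fin n ⊕ Fin n) ℂ) ∧
      Matrix.fromBlocks (Xᴴ * A * X + Yᴴ * B * Y) 0 0 (Yᴴ * A * Y + Xᴴ * B * X) =
        (1 / (2 * (n : ℂ))) • ∑ k, U k * Matrix.fromBlocks A 0 0 B * (U k)ᴴ := by
  have hT : (Matrix.fromBlocks A 0 0 B).IsHermitian := hA.fromBlocks (by simp) hB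
  obtain ⟨U, hU, h⟩ := hT.exists_unitary_average (N := 2 * n) (by simp [two_mul])
    ![Matrix.fromBlocks Xᴴ 0 0 Xᴴ, Matrix.fromBlocks 0 Yᴴ Yᴴ 0]
    (by simp [Fin.sum_univ_two, Matrix.fromBlocks_conjTranspose, Matrix.fromBlocks_multiply,
      Matrix.fromBlocks_add, hXY])
    (by simp [Fin.sum_univ_two, Matrix.fromBlocks_conjTranspose, Matrix.fromBlocks_multiply,
      Matrix.fromBlocks_add, hXY'])
  refine ⟨U, hU, ?_⟩
  rw [Nat.cast_mul, Nat.cast_ofNat] at h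
  rw [← h]
  simp [Fin.sum_univ_two, Matrix.fromBlocks_conjTranspose, Matrix.fromBlocks_multiply,
    Matrix.fromBlocks_add, add_comm]
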